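/- Let $d\in\{-1,-2,-3,-7,-11,-19,-43,-67,-163\}$, let $\mathcal O_d$ be the subring $\mathbb Z\left[\frac{1+\sqrt d}{2}\right]$ of $\mathbb C$ if $d\equiv 1\pmod 4$ and $\mathbb Z[\sqrt d]$ otherwise, where $\sqrt d=i\sqrt{|d|}$. Put $\theta_{-1}=\pi/2$, $\theta_{-3}=\pi/3$ and $\theta_d=\pi$ for the other $d$, and let $A(d)$ be the set of all $x\in\mathcal O_d\setminus\{0\}$ with $0\le\arg(x)<\theta_d$, where $\arg(x)\in[0,2\pi)$ (so $A(d)$ contains exactly one associate of each nonzero element of $\mathcal O_d$). For a positive integer $n$ and $z\in\mathcal O_d\setminus\{0\}$ define $$\delta_n(z)=\sum_{\substack{x\mid z\\ x\in A(d)}}|x|^n,\qquad I_n(z)=\frac{\delta_n(z)}{|z|^n},$$ where divisibility is in $\mathcal O_d$ and $|\cdot|$ is the complex absolute value. For an integer $t\ge 2$, call $z\in\mathcal O_d\setminus\{0\}$ $n$-powerfully $t$-perfect in $\mathcal O_d$ if $I_n(z)=t$. Then, for every integer $n\ge 3$: 1. $I_n(z)<2$ for every $z\in\mathcal O_d\setminus\{0\}$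 such that $I_n(z)$ is rational; 2. for every integer $t\ge 2$ there are no $n$-powerfully $t$-perfect numbers in $\mathcal O_d$. -/

import Mathlib

namespace QuadPerfect

/-- The nine negative integers `d` for which the ring of integers of `ℚ(√d)` is a UFD. -/
def K : Set ℤ := {-163, -67, -43, -19, -11, -7, -3, -2, -1}

/-- The complex number `√d = i √|d|`, for `d < 0`. -/
noncomputable def sqrtNeg (d : ℤ) : ℂ := (Real.sqrt (-(d : ℝ)) : ℂ) * Complex.I

/-- The generator of the quadratic integer ring: `(1 + √d) / 2` if `d ≡ 1 (mod 4)`, and `√d`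
otherwise. -/
noncomputable def omega (d : ℤ) : ℂ :=
  if d ≡ 1 [ZMOD 4] then (1 + sqrtNeg d) / 2 else sqrtNeg d

/-- The quadratic integer ring `ℤ[(1 + √d) / 2]` (if `d ≡ 1 (mod 4)`) or `ℤ[√d]` (otherwise), for
`d < 0` square-free, as a subring of `ℂ`. For `z` in this ring, the conjugate is the complex
conjugate, so that `√(N(z))` is the complex absolute value `‖(z : ℂ)‖`. -/
noncomputable abbrev QuadRing (d : ℤ) : Subalgebra ℤ ℂ := Algebra.adjoin ℤ {omega d}

/-- The sector `A(d)`, which contains exactly one associate of each nonzero element. (An argument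
in `[0, π)` is the same in the convention `(-π, π]` of `Complex.arg` and in the convention
`[0, 2π)`.) -/
def A (d : ℤ) : Set (QuadRing d) :=
  {z | z ≠ 0 ∧ 0 ≤ Complex.arg (z : ℂ) ∧ Complex.arg (z : ℂ) <
    if d = -1 then Real.pi / 2 else if d = -3 then Real.pi / 3 else Real.pi}

/-- `δ_n(z) = ∑ |x|^n`, the sum over all `x ∈ A(d)` that divide `z` in the ring. For `d < 0` and
`z ≠ 0` the index set is finite, see `finite_divisors` below. -/
noncomputable def delta (d : ℤ) (n : ℤ) (z : QuadRing d) : ℝ :=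
  ∑ᶠ x ∈ {x : QuadRing d | x ∣ z ∧ x ∈ A d}, ‖(x : ℂ)‖ ^ n

/-- `I_n(z) = δ_n(z) / |z|^n`. -/
noncomputable def abundancy (d : ℤ) (n : ℕ) (z : QuadRing d) : ℝ :=
  delta d n z / ‖(z : ℂ)‖ ^ n

/-- `z` is `n`-powerfully `t`-perfect (used for `n ≥ 1` and `t ≥ 2`). -/
def IsPowerfullyPerfect (d : ℤ) (n t : ℕ) (z : QuadRing d) : Prop :=
  z ≠ 0 ∧ abundancy d n z = t

/-- The norm `N(a + bω)` is an integer. -/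
theorem exists_normSq (d : ℤ) (hd : d < 0) (a b : ℤ) :
    ∃ k : ℤ, Complex.normSq ((a : ℂ) + b * omega d) = k := by
  have hs : Real.sqrt (-(d : ℝ)) ^ 2 = -(d : ℝ) := Real.sq_sqrt (by
    have : (d : ℝ) < 0 := by exact_mod_cast hd
    linarith)
  by_cases h : d ≡ 1 [ZMOD 4]
  · obtain ⟨m, hm⟩ := h.dvd
    refine ⟨a ^ 2 + a * b + b ^ 2 * m, ?_⟩
    have hm' : (1 : ℝ) - d = 4 * m := by exact_mod_cast hm
    simp [omega, h, sqrtNeg, Complex.normSq_apply]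
    linear_combination (b : ℝ) ^ 2 / 4 * hs + (b : ℝ) ^ 2 / 4 * hm'
  · refine ⟨a ^ 2 - d * b ^ 2, ?_⟩
    simp [omega, h, sqrtNeg, Complex.normSq_apply]
    linear_combination (b : ℝ) ^ 2 * hs

/-- `ω` satisfies a monic quadratic equation over `ℤ`. -/
theorem omega_sq (d : ℤ) (hd : d < 0) :
    ∃ u v : ℤ, omega d * omega d = (u : ℂ) + v * omega d := by
  have hs : sqrtNeg d ^ 2 = d := by
    have hs : Real.sqrt (-(d : ℝ)) ^ 2 = -(d : ℝ) := Real.sq_sqrt (by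
      have : (d : ℝ) < 0 := by exact_mod_cast hd
      linarith)
    rw [sqrtNeg, mul_pow, Complex.I_sq, ← Complex.ofReal_pow, hs]
    push_cast
    ring
  by_cases h : d ≡ 1 [ZMOD 4]
  · obtain ⟨m, hm⟩ := h.dvd
    have hm' : (1 : ℂ) - d = 4 * m := by exact_mod_cast hm
    refine ⟨-m, 1, ?_⟩
    simp only [omega, h, if_true]
    push_cast
    linear_combination hs / 4 - hm' / 4
  · refine ⟨d, 0, ?_⟩
    simp only [omega, h, if_false]
    push_cast
    linear_combination hs

/-- Every element of the ring is `a + bω` with integers `a` and `b`. -/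
theorem exists_coords (d : ℤ) (hd : d < 0) (z : QuadRing d) :
    ∃ a b : ℤ, (z : ℂ) = a + b * omega d := by
  obtain ⟨z, hz⟩ := z
  obtain ⟨u, v, huv⟩ := omega_sq d hd
  induction hz using Algebra.adjoin_induction with
  | mem x hx => exact ⟨0, 1, by simpa using hx⟩
  | algebraMap r => exact ⟨r, 0, by simp⟩
  | add x y _ _ hx hy =>
    obtain ⟨a, b, h⟩ := hx
    obtain ⟨a', b', h'⟩ := hy
    refine ⟨a + a', b + b', ?_⟩
    simp only at h h' ⊢
    rw [h, h']
    push_cast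
    ring
  | mul x y _ _ hx hy =>
    obtain ⟨a, b, h⟩ := hx
    obtain ⟨a', b', h'⟩ := hy
    refine ⟨a * a' + b * b' * u, a * b' + a' * b + b * b' * v, ?_⟩
    simp only at h h' ⊢
    rw [h, h']
    push_cast
    linear_combination (b : ℂ) * b' * huv

/-- Nonzero elements of the ring have absolute value at least `1`. -/
theorem one_le_norm (d : ℤ) (hd : d < 0) (z : QuadRing d) (hz : z ≠ 0) : 1 ≤ ‖(z : ℂ)‖ := by
  obtain ⟨a, b, h⟩ := exists_coords d hd z
  obtain ⟨k, hk⟩ := exists_normSq d hd a b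
  have h0 : (z : ℂ) ≠ 0 := by simpa using hz
  have hp : 0 < Complex.normSq (z : ℂ) := Complex.normSq_pos.2 h0
  rw [h, hk] at hp
  have hk1 : (1 : ℝ) ≤ k := by exact_mod_cast (Int.cast_pos.1 hp : 0 < k)
  rw [← hk, ← h, Complex.normSq_eq_norm_sq] at hk1
  nlinarith [norm_nonneg (z : ℂ)]

/-- A nonzero element has finitely many divisors, so that the sum `delta` is a finite sum. -/
theorem finite_divisors (d : ℤ) (hd : d < 0) (z : QuadRing d) (hz : z ≠ 0) :
    {x : QuadRing d | x ∣ z ∧ x ∈ A d}.Finite := by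
  have hs : 1 ≤ Real.sqrt (-(d : ℝ)) := by
    rw [Real.one_le_sqrt]
    have : d ≤ -1 := by omega
    have : (d : ℝ) ≤ -1 := by exact_mod_cast this
    linarith
  have him : (1 : ℝ) / 2 ≤ (omega d).im := by
    by_cases h : d ≡ 1 [ZMOD 4] <;> simp [omega, h, sqrtNeg] <;> linarith
  obtain ⟨R, hR⟩ := exists_nat_ge ‖(z : ℂ)‖
  obtain ⟨S, hS⟩ := exists_nat_ge ‖omega d‖
  let T : Set (ℤ × ℤ) := Set.Icc (-(R + 2 * R * S : ℤ)) (R + 2 * R * S) ×ˢ Set.Icc (-(2 * R : ℤ)) (2 * R)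
  have hT : T.Finite := (Set.finite_Icc _ _).prod (Set.finite_Icc _ _)
  refine Set.Finite.of_finite_image (f := fun x : QuadRing d => (x : ℂ)) ?_
    Subtype.val_injective.injOn
  refine (hT.image fun p : ℤ × ℤ => (p.1 : ℂ) + p.2 * omega d).subset ?_
  rintro _ ⟨x, ⟨⟨y, hy⟩, -⟩, rfl⟩
  have hy0 : y ≠ 0 := by
    rintro rfl
    exact hz (by simpa using hy)
  have h1 := one_le_norm d hd y hy0
  have hxR : ‖(x : ℂ)‖ ≤ R := by
    have : ‖(z : ℂ)‖ = ‖(x : ℂ)‖ * ‖(y : ℂ)‖ := by rw [hy]; simp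
    nlinarith [norm_nonneg (x : ℂ)]
  obtain ⟨a, b, h⟩ := exists_coords d hd x
  have hb : |(b : ℝ)| ≤ 2 * R := by
    have h2 := Complex.abs_im_le_norm (x : ℂ)
    have h3 : (x : ℂ).im = b * (omega d).im := by rw [h]; simp
    rw [h3, abs_mul, abs_of_pos (by linarith : 0 < (omega d).im)] at h2
    nlinarith [abs_nonneg (b : ℝ)]
  have ha : |(a : ℝ)| ≤ R + 2 * R * S := by
    have h2 : (a : ℂ) = x - b * omega d := by rw [h]; ring
    have h3 : |(a : ℝ)| = ‖(a : ℂ)‖ := by simp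
    have h4 : ‖(b : ℂ) * omega d‖ = |(b : ℝ)| * ‖omega d‖ := by simp
    have h5 : |(b : ℝ)| * ‖omega d‖ ≤ 2 * R * S := by gcongr
    rw [h3, h2]
    have := norm_sub_le (x : ℂ) ((b : ℂ) * omega d)
    linarith
  refine ⟨(a, b), ⟨?_, ?_⟩, h.symm⟩
  · exact Set.mem_Icc.2 (abs_le.1 (by exact_mod_cast ha))
  · exact Set.mem_Icc.2 (abs_le.1 (by exact_mod_cast hb))

end QuadPerfect

namespace QuadPerfect

/-! Replacing a divisor $x$ of $z$ by the codivisor $y=z/x$ turns $I_n(z)$ into a finite sum of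
$|y|^{-n}$. With $w$ the number of sectors of the size of $A(d)$ around the origin, the products of
the codivisors with the $w$-th roots of unity are distinct lattice points. Hence $w\,I_n(z)$ is a
partial sum of $\sum N(p)^{-n/2}$ over the lattice, and a bound below $2w$ suffices. Unique
factorization plays no role.

For $n\ge 4$ the whole lattice sum of $N(p)^{-2}$ is below $2w$ (`sum_inv_normForm_sq_le`). This
bound is not available for $n=3$: for $d=-1$ the full sum of $N(p)^{-3/2}$ exceeds $2w$. There
rationality enters. The terms are nonnegative square roots of rationals, so by a Galois argument
(`rational_of_sum_sqrt_rational`) each is rational, which for odd $n$ forces every $|y|$ to be an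
integer. Only points whose norm is a perfect square survive, and their sum is below $2w$
(`sum_inv_sqrt_normForm_cube_le`). Each lattice bound is an exact finite computation plus a tail
estimate. -/

/-! ### Rationality of sums of square roots -/

/-- If a sum of nonnegative square roots of rational numbers is rational, then every term is. -/
theorem rational_of_sum_sqrt_rational {ι : Type*} (s : Finset ι) (t : ι → ℝ)
    (h0 : ∀ i ∈ s, 0 ≤ t i) (hsq : ∀ i ∈ s, ∃ q : ℚ, t i ^ 2 = q)
    (hs : ∃ q : ℚ, ∑ i ∈ s, t i = q) : ∀ j ∈ s, ∃ q : ℚ, t j = q := by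
  classical
  intro j hj
  have hint : ∀ i ∈ s, (t i : ℂ) ∈ algebraicClosure ℚ ℂ := by
    intro i hi
    obtain ⟨q, hq⟩ := hsq i hi
    rw [mem_algebraicClosure_iff]
    refine IsAlgebraic.of_pow (n := 2) (by norm_num) ?_
    have : (t i : ℂ) ^ 2 = algebraMap ℚ ℂ q := by
      rw [← Complex.ofReal_pow, hq]
      simp
    rw [this]
    exact isAlgebraic_algebraMap q
  let L := algebraicClosure ℚ ℂ
  have : IsAlgClosure ℚ L := algebraicClosure.isAlgClosure ℚ ℂ
  have : Normal ℚ L := IsAlgClosure.normal ℚ L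
  have : IsGalois ℚ L := IsGalois.mk
  let T : ι → L := fun i => if hi : i ∈ s then ⟨t i, hint i hi⟩ else 0
  have hT : ∀ i ∈ s, (T i : ℂ) = t i := fun i hi => by simp [T, hi]
  by_cases hfix : ∀ σ : L ≃ₐ[ℚ] L, σ (T j) = T j
  · have := (InfiniteGalois.mem_bot_iff_fixed (k := ℚ) (T j)).2 hfix
    obtain ⟨q, hq⟩ := IntermediateField.mem_bot.1 this
    refine ⟨q, ?_⟩
    have h1 : ((algebraMap ℚ L q : L) : ℂ) = t j := by rw [hq, hT j hj]
    have h2 : ((algebraMap ℚ L q : L) : ℂ) = ((q : ℝ) : ℂ) := by simp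
    rw [h2] at h1
    exact_mod_cast h1.symm
  · push Not at hfix
    obtain ⟨σ, hσ⟩ := hfix
    have hpm : ∀ i ∈ s, σ (T i) = T i ∨ σ (T i) = -T i := by
      intro i hi
      obtain ⟨q, hq⟩ := hsq i hi
      have h1 : T i ^ 2 = algebraMap ℚ L q := by
        apply Subtype.ext
        push_cast
        rw [hT i hi, ← Complex.ofReal_pow, hq]
        simp
      have h2 : σ (T i) ^ 2 = T i ^ 2 := by rw [← map_pow, h1, AlgEquiv.commutes]
      exact sq_eq_sq_iff_eq_or_eq_neg.1 h2
    -- Each conjugate is $\pm t_i$ with $t_i\ge 0$, so `σ` can only lower real parts. Moving `T j`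
    -- lowers the sum strictly, although the rational total is fixed by `σ`.
    have hre : ∀ i ∈ s, ((σ (T i) : L) : ℂ).re ≤ t i := by
      intro i hi
      rcases hpm i hi with h | h <;> rw [h]
      · rw [hT i hi]; simp
      · push_cast
        rw [hT i hi]
        simp only [Complex.neg_re, Complex.ofReal_re]
        linarith [h0 i hi]
    have hj' : ((σ (T j) : L) : ℂ).re < t j := by
      rcases hpm j hj with h | h
      · exact absurd h hσ
      · rw [h]
        push_cast
        rw [hT j hj]
        simp only [Complex.neg_re, Complex.ofReal_re]
        have hne : t j ≠ 0 := by
          intro h3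
          have : T j = 0 := Subtype.ext (by rw [hT j hj, h3]; simp)
          exact hσ (by rw [this, map_zero])
        have := lt_of_le_of_ne (h0 j hj) hne.symm
        linarith
    have hlt : ∑ i ∈ s, ((σ (T i) : L) : ℂ).re < ∑ i ∈ s, t i :=
      Finset.sum_lt_sum hre ⟨j, hj, hj'⟩
    obtain ⟨q, hq⟩ := hs
    have h4 : ∑ i ∈ s, T i = algebraMap ℚ L q := by
      apply Subtype.ext
      rw [AddSubmonoidClass.coe_finsetSum, Finset.sum_congr rfl hT, ← Complex.ofReal_sum, hq]
      simp
    have h5 : ∑ i ∈ s, σ (T i) = algebraMap ℚ L q := by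
      rw [← map_sum, h4, AlgEquiv.commutes]
    have h6 : ∑ i ∈ s, ((σ (T i) : L) : ℂ).re = q := by
      rw [← Complex.re_sum, ← AddSubmonoidClass.coe_finsetSum, h5]
      simp
    linarith

/-! ### Lattice sums of the norm forms -/

/-- The binary quadratic form `a² + eab + cb²`. -/
def normForm (e c : ℤ) (p : ℤ × ℤ) : ℤ := p.1 ^ 2 + e * p.1 * p.2 + c * p.2 ^ 2

/-- Complete the square: $4(a^2+ab+b^2)=3a^2+(a+2b)^2$, and symmetrically in $b$. -/
theorem three_mul_sq_le_normForm {e c : ℤ} (he : e = 0 ∨ e = 1) (hc : 1 ≤ c) (p : ℤ × ℤ) :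
    3 * p.1 ^ 2 ≤ 4 * normForm e c p ∧ 3 * p.2 ^ 2 ≤ 4 * normForm e c p := by
  have h : p.2 ^ 2 ≤ c * p.2 ^ 2 := le_mul_of_one_le_left (sq_nonneg _) hc
  unfold normForm
  rcases he with rfl | rfl
  · constructor <;> nlinarith [sq_nonneg p.1, sq_nonneg p.2]
  · constructor
    · nlinarith [sq_nonneg (p.1 + 2 * p.2)]
    · nlinarith [sq_nonneg (2 * p.1 + p.2)]

/-- The constant bounds the tail outside the box. The shell $\max(|a|,|b|)=k$ has $8k$ points of
norm at least $3k^2/4$, so it contributes at most $\frac{128}{9}k^{-3}\le\frac{128}{81}k^{-2}$ for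
$k\ge 9$, and $\sum_{k>8}k^{-2}\le\frac18$. The origin is harmless because `0⁻¹ = 0`. -/
theorem sum_inv_normForm_sq_le {e c : ℤ} (he : e = 0 ∨ e = 1) (hc : 1 ≤ c)
    (T : Finset (ℤ × ℤ)) :
    ∑ p ∈ T, ((normForm e c p : ℝ) ^ 2)⁻¹ ≤
      ((∑ p ∈ Finset.Icc (-8 : ℤ) 8 ×ˢ Finset.Icc (-8 : ℤ) 8,
        ((normForm e c p : ℚ) ^ 2)⁻¹ : ℚ) : ℝ) + 16 / 81 := by
  let r : ℤ × ℤ → ℕ := fun p => max p.1.natAbs p.2.natAbs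
  rw [← Finset.sum_filter_add_sum_filter_not T (fun p => r p ≤ 8)]
  apply add_le_add
  · push_cast
    apply Finset.sum_le_sum_of_subset_of_nonneg
    · intro p hp
      have := (Finset.mem_filter.1 hp).2
      simp only [r, sup_le_iff] at this
      simp only [Finset.mem_product, Finset.mem_Icc]
      omega
    · intros
      positivity
  -- The outer maximum keeps the upper end at least 8, as `sum_Ioc_inv_sq_le_sub` requires.
  · have hmaps : ∀ p ∈ T.filter (fun p => ¬ r p ≤ 8), r p ∈ Finset.Ioc 8 (max 8 (T.sup r)) := by
      intro p hp
      obtain ⟨h1, h2⟩ := Finset.mem_filter.1 hp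
      exact Finset.mem_Ioc.2 ⟨not_le.1 h2, (Finset.le_sup (f := r) h1).trans (le_max_right _ _)⟩
    rw [← Finset.sum_fiberwise_of_maps_to hmaps]
    calc _ ≤ ∑ k ∈ Finset.Ioc 8 (max 8 (T.sup r)), (128 / 81 : ℝ) * ((k : ℝ) ^ 2)⁻¹ := by
          apply Finset.sum_le_sum
          intro k hk
          have hk8 := (Finset.mem_Ioc.1 hk).1
          have hkr : (9 : ℝ) ≤ k := by exact_mod_cast hk8
          have hterm : ∀ p ∈ (T.filter (fun p => ¬ r p ≤ 8)).filter (fun p => r p = k),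
              ((normForm e c p : ℝ) ^ 2)⁻¹ ≤ 16 / 9 * ((k : ℝ) ^ 4)⁻¹ := by
            intro p hp
            have hp := (Finset.mem_filter.1 hp).2
            obtain ⟨h1, h2⟩ := three_mul_sq_le_normForm he hc p
            have h3 : 3 * (k : ℤ) ^ 2 ≤ 4 * normForm e c p := by
              rcases le_total p.1.natAbs p.2.natAbs with h | h
              · have : (k : ℤ) ^ 2 = p.2 ^ 2 := by
                  rw [← hp, show r p = p.2.natAbs from max_eq_right h, Int.natAbs_sq]
                rwa [this]
              · have : (k : ℤ) ^ 2 = p.1 ^ 2 := by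
                  rw [← hp, show r p = p.1.natAbs from max_eq_left h, Int.natAbs_sq]
                rwa [this]
            have h4 : 3 * (k : ℝ) ^ 2 ≤ 4 * normForm e c p := by exact_mod_cast h3
            have h5 : (3 / 4 * (k : ℝ) ^ 2) ^ 2 ≤ (normForm e c p : ℝ) ^ 2 :=
              pow_le_pow_left₀ (by positivity) (by linarith) 2
            calc _ ≤ ((3 / 4 * (k : ℝ) ^ 2) ^ 2)⁻¹ := inv_anti₀ (by positivity) h5
              _ = _ := by field_simp; norm_num
          refine (Finset.sum_le_card_nsmul _ _ _ hterm).trans ?_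
          have hcard : ((T.filter (fun p => ¬ r p ≤ 8)).filter (fun p => r p = k)).card ≤
              8 * k := by
            rw [← Int.card_box (by omega : k ≠ 0)]
            exact Finset.card_le_card fun p hp => Int.mem_box.2 (Finset.mem_filter.1 hp).2
          have hcard' : (((T.filter (fun p => ¬ r p ≤ 8)).filter (fun p => r p = k)).card : ℝ) ≤
              8 * k := by exact_mod_cast hcard
          rw [nsmul_eq_mul]
          calc _ ≤ 8 * (k : ℝ) * (16 / 9 * ((k : ℝ) ^ 4)⁻¹) := by gcongr
            _ = 128 / 9 * ((k : ℝ) ^ 2)⁻¹ * (k : ℝ)⁻¹ := by field_simp; norm_num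
            _ ≤ 128 / 9 * ((k : ℝ) ^ 2)⁻¹ * (9 : ℝ)⁻¹ := by gcongr
            _ = _ := by ring
      _ ≤ (128 / 81 : ℝ) * (8 : ℝ)⁻¹ := by
          rw [← Finset.mul_sum]
          gcongr
          refine (sum_Ioc_inv_sq_le_sub (by norm_num) (le_max_left _ _)).trans ?_
          push_cast
          have : (0 : ℝ) ≤ (max 8 ((T.sup r : ℕ) : ℝ))⁻¹ := by positivity
          linarith
      _ = _ := by norm_num

/-- The circle `normForm e c = m²` has at most `14m/3 + 2` lattice points. -/
theorem card_normForm_eq_sq_le {e c : ℤ} (he : e = 0 ∨ e = 1) (hc : 1 ≤ c) (m : ℕ)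
    (T : Finset (ℤ × ℤ)) (hT : ∀ p ∈ T, normForm e c p = (m : ℤ) ^ 2) :
    (T.card : ℝ) ≤ 14 / 3 * m + 2 := by
  have h1 : T.card ≤ 2 * (T.image Prod.snd).card := by
    apply Finset.card_le_mul_card_image
    intro b _
    rcases (T.filter (fun p => p.2 = b)).eq_empty_or_nonempty with h | ⟨p, hp⟩
    · simp [h]
    · obtain ⟨hp1, hp2⟩ := Finset.mem_filter.1 hp
      -- For fixed `b` the equation is a monic quadratic in the first coordinate, whose roots add up
      -- to `-e * b`.
      refine (Finset.card_le_card (t := {(p.1, b), (-e * b - p.1, b)}) ?_).trans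
        Finset.card_le_two
      intro q hq
      obtain ⟨hq1, hq2⟩ := Finset.mem_filter.1 hq
      have h := (hT q hq1).trans (hT p hp1).symm
      simp only [normForm, hp2, hq2] at h
      have h3 : (q.1 - p.1) * (q.1 + e * b + p.1) = 0 := by linear_combination h
      simp only [Finset.mem_insert, Finset.mem_singleton, Prod.ext_iff]
      rcases mul_eq_zero.1 h3 with h4 | h4
      · exact Or.inl ⟨by linarith, hq2⟩
      · exact Or.inr ⟨by linarith, hq2⟩
  have h2 : (T.image Prod.snd).card ≤ 2 * (7 * m / 6) + 1 := by
    have : T.image Prod.snd ⊆ Finset.Icc (-((7 * m / 6 : ℕ) : ℤ)) (7 * m / 6 : ℕ) := by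
      intro b hb
      obtain ⟨p, hp, rfl⟩ := Finset.mem_image.1 hb
      have h3 := (three_mul_sq_le_normForm he hc p).2
      rw [hT p hp] at h3
      -- Here $7/6$ is a rational upper bound for $2/\sqrt3$: $36\cdot\frac43=48\le 49$.
      have h4 : (6 * p.2) ^ 2 ≤ (7 * (m : ℤ)) ^ 2 := by nlinarith [sq_nonneg (m : ℤ)]
      have h5 := abs_le.1 (abs_le_of_sq_le_sq h4 (by positivity))
      rw [Finset.mem_Icc]
      omega
    refine (Finset.card_le_card this).trans ?_
    rw [Int.card_Icc]
    omega
  have h3 : 6 * (7 * m / 6) ≤ 7 * m := Nat.mul_div_le _ _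
  have h4 : 3 * T.card ≤ 14 * m + 6 := by omega
  have h5 : (3 : ℝ) * T.card ≤ 14 * m + 6 := by exact_mod_cast h4
  linarith

/-- Points are grouped by $m=\sqrt N$. For $m\le 8$ both coordinates have square at most
$256/3<10^2$, whence the box of radius 9. For $m>8$ there are at most
$\frac{14}{3}m+2\le\frac{59}{12}m$ points, and $\frac{59}{12}\sum_{m>8}m^{-2}\le\frac{59}{96}$. -/
theorem sum_inv_sqrt_normForm_cube_le {e c : ℤ} (he : e = 0 ∨ e = 1) (hc : 1 ≤ c)
    (T : Finset (ℤ × ℤ)) (r : ℤ × ℤ → ℕ) (hr0 : ∀ p ∈ T, r p ≠ 0)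
    (hr : ∀ p ∈ T, normForm e c p = (r p : ℤ) ^ 2) :
    ∑ p ∈ T, ((r p : ℝ) ^ 3)⁻¹ ≤
      ((∑ m ∈ Finset.Icc (1 : ℕ) 8, ∑ p ∈ Finset.Icc (-9 : ℤ) 9 ×ˢ Finset.Icc (-9 : ℤ) 9,
        if normForm e c p = (m : ℤ) ^ 2 then ((m : ℚ) ^ 3)⁻¹ else 0 : ℚ) : ℝ) + 59 / 96 := by
  rw [← Finset.sum_filter_add_sum_filter_not T (fun p => r p ≤ 8)]
  apply add_le_add
  · have hmaps : ∀ p ∈ T.filter (fun p => r p ≤ 8), r p ∈ Finset.Icc 1 8 := by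
      intro p hp
      obtain ⟨h1, h2⟩ := Finset.mem_filter.1 hp
      exact Finset.mem_Icc.2 ⟨Nat.one_le_iff_ne_zero.2 (hr0 p h1), h2⟩
    rw [← Finset.sum_fiberwise_of_maps_to hmaps]
    push_cast
    apply Finset.sum_le_sum
    intro m hm
    simp only [apply_ite (Rat.cast : ℚ → ℝ), Rat.cast_zero, Rat.cast_inv, Rat.cast_pow, Rat.cast_natCast]
    rw [Finset.sum_congr rfl (g := fun _ => ((m : ℝ) ^ 3)⁻¹)
      (fun p hp => by rw [(Finset.mem_filter.1 hp).2]), ← Finset.sum_filter]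
    apply Finset.sum_le_sum_of_subset_of_nonneg
    · intro p hp
      obtain ⟨hp, hpm⟩ := Finset.mem_filter.1 hp
      have hpT := (Finset.mem_filter.1 hp).1
      have hQ := hr p hpT
      rw [hpm] at hQ
      obtain ⟨h1, h2⟩ := three_mul_sq_le_normForm he hc p
      have hm8 : (m : ℤ) ≤ 8 := by exact_mod_cast (Finset.mem_Icc.1 hm).2
      have hm2 : (m : ℤ) ^ 2 ≤ 64 := by nlinarith
      have h3 := abs_lt.1 (abs_lt_of_sq_lt_sq (by linarith : p.1 ^ 2 < 10 ^ 2) (by norm_num))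
      have h4 := abs_lt.1 (abs_lt_of_sq_lt_sq (by linarith : p.2 ^ 2 < 10 ^ 2) (by norm_num))
      simp only [Finset.mem_filter, Finset.mem_product, Finset.mem_Icc]
      exact ⟨by omega, hQ⟩
    · intros
      positivity
  · have hmaps : ∀ p ∈ T.filter (fun p => ¬ r p ≤ 8), r p ∈ Finset.Ioc 8 (max 8 (T.sup r)) := by
      intro p hp
      obtain ⟨h1, h2⟩ := Finset.mem_filter.1 hp
      exact Finset.mem_Ioc.2 ⟨not_le.1 h2, (Finset.le_sup (f := r) h1).trans (le_max_right _ _)⟩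
    rw [← Finset.sum_fiberwise_of_maps_to hmaps]
    calc _ ≤ ∑ k ∈ Finset.Ioc 8 (max 8 (T.sup r)), (59 / 12 : ℝ) * ((k : ℝ) ^ 2)⁻¹ := by
          apply Finset.sum_le_sum
          intro k hk
          have hk8 := (Finset.mem_Ioc.1 hk).1
          have hkr : (8 : ℝ) ≤ k := by exact_mod_cast hk8.le
          rw [Finset.sum_congr rfl (g := fun _ => ((k : ℝ) ^ 3)⁻¹)
            (fun p hp => by rw [(Finset.mem_filter.1 hp).2]), Finset.sum_const, nsmul_eq_mul]
          have hcard := card_normForm_eq_sq_le he hc k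
            ((T.filter (fun p => ¬ r p ≤ 8)).filter (fun p => r p = k)) (by
              intro p hp
              obtain ⟨hp, hpk⟩ := Finset.mem_filter.1 hp
              rw [hr p (Finset.mem_filter.1 hp).1, hpk])
          calc _ ≤ (59 / 12 * (k : ℝ)) * ((k : ℝ) ^ 3)⁻¹ := by
                gcongr
                linarith
            _ = _ := by field_simp
      _ ≤ (59 / 12 : ℝ) * (8 : ℝ)⁻¹ := by
          rw [← Finset.mul_sum]
          gcongr
          refine (sum_Ioc_inv_sq_le_sub (by norm_num) (le_max_left _ _)).trans ?_
          push_cast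
          have : (0 : ℝ) ≤ (max 8 ((T.sup r : ℕ) : ℝ))⁻¹ := by positivity
          linarith
      _ = _ := by norm_num

/-- A binary quadratic form `a² + eab + cb²` whose lattice sums are less than `2w`. -/
structure SmallLatticeSums (e c : ℤ) (w : ℕ) : Prop where
  middle : e = 0 ∨ e = 1
  last : 1 ≤ c
  inv_sq : ∑ p ∈ Finset.Icc (-8 : ℤ) 8 ×ˢ Finset.Icc (-8 : ℤ) 8,
    ((normForm e c p : ℚ) ^ 2)⁻¹ + 16 / 81 < 2 * w
  inv_cube : (∑ m ∈ Finset.Icc (1 : ℕ) 8, ∑ p ∈ Finset.Icc (-9 : ℤ) 9 ×ˢ Finset.Icc (-9 : ℤ) 9,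
    if normForm e c p = (m : ℤ) ^ 2 then ((m : ℚ) ^ 3)⁻¹ else 0) + 59 / 96 < 2 * w

/-! ### From divisors to lattice points -/

/-- A sector of opening `2π/w` meets each orbit of multiplication by `w`-th roots of unity at most
once. -/
theorem sector_injective {w : ℕ} (hw : 0 < w) {x y : ℂ} (hx0 : 0 ≤ Complex.arg x)
    (hx : Complex.arg x < 2 * Real.pi / w) (hy0 : 0 ≤ Complex.arg y)
    (hy : Complex.arg y < 2 * Real.pi / w) (hx1 : x ≠ 0) {k l : ℕ} (hk : k < w) (hl : l < w)
    (h : Complex.exp (2 * Real.pi * Complex.I / w) ^ k * x =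
      Complex.exp (2 * Real.pi * Complex.I / w) ^ l * y) : k = l ∧ x = y := by
  have hw' : (0 : ℝ) < w := by exact_mod_cast hw
  have hwc : (w : ℂ) ≠ 0 := by exact_mod_cast hw.ne'
  have hu : ‖Complex.exp (2 * Real.pi * Complex.I / w)‖ = 1 := by
    have := Complex.norm_exp_ofReal_mul_I (2 * Real.pi / w)
    rw [← this]
    congr 2
    push_cast
    ring
  have hn : ‖x‖ = ‖y‖ := by simpa [hu] using congrArg norm h
  have hxn : (‖x‖ : ℂ) ≠ 0 := by simpa using hx1
  have hexp : Complex.exp (k * (2 * Real.pi * Complex.I / w) + Complex.arg x * Complex.I) =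
      Complex.exp (l * (2 * Real.pi * Complex.I / w) + Complex.arg y * Complex.I) := by
    rw [Complex.exp_add, Complex.exp_add, Complex.exp_nat_mul, Complex.exp_nat_mul]
    apply mul_left_cancel₀ hxn
    calc _ = Complex.exp (2 * Real.pi * Complex.I / w) ^ k *
          (‖x‖ * Complex.exp (Complex.arg x * Complex.I)) := by ring
      _ = Complex.exp (2 * Real.pi * Complex.I / w) ^ l *
          (‖y‖ * Complex.exp (Complex.arg y * Complex.I)) := by
        rw [Complex.norm_mul_exp_arg_mul_I, Complex.norm_mul_exp_arg_mul_I, h]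
      _ = _ := by rw [hn]; ring
  obtain ⟨n, hexp⟩ := Complex.exp_eq_exp_iff_exists_int.1 hexp
  have hreal : Complex.arg x - Complex.arg y =
      ((l - k + n * w : ℤ) : ℝ) * (2 * Real.pi / w) := by
    have : ((Complex.arg x - Complex.arg y : ℝ) : ℂ) =
        ((((l - k + n * w : ℤ) : ℝ) * (2 * Real.pi / w) : ℝ) : ℂ) := by
      apply mul_right_cancel₀ Complex.I_ne_zero
      push_cast
      have h2 : (n : ℂ) * (2 * Real.pi * Complex.I) =
        n * w * (2 * Real.pi / w) * Complex.I := by field_simp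
      rw [h2] at hexp
      linear_combination hexp
    exact_mod_cast this
  have hθ : 0 < 2 * Real.pi / w := by positivity
  -- Both arguments lie in $[0,2\pi/w)$, so their difference is a multiple of $2\pi/w$ of absolute
  -- value below $2\pi/w$.
  have hzero : (l - k + n * w : ℤ) = 0 := by
    have h1 : ((l - k + n * w : ℤ) : ℝ) < 1 := by
      by_contra! hge
      nlinarith
    have h2 : (-1 : ℝ) < ((l - k + n * w : ℤ) : ℝ) := by
      by_contra! hge
      nlinarith
    have h1' : (l - k + n * w : ℤ) < 1 := by exact_mod_cast h1
    have h2' : -1 < (l - k + n * w : ℤ) := by exact_mod_cast h2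
    omega
  constructor
  · have hn0 : n = 0 := by
      by_contra hne
      rcases lt_or_gt_of_ne hne with h' | h' <;> nlinarith
    subst hn0
    omega
  · rw [hzero] at hreal
    have harg : Complex.arg x = Complex.arg y := by simpa [sub_eq_zero] using hreal
    rw [← Complex.norm_mul_exp_arg_mul_I x, hn, harg, Complex.norm_mul_exp_arg_mul_I]

/-- The norm form of `QuadRing d` is `a² + eab + cb²`, and the ring contains the `w`-th roots of
unity, for which `A d` is a fundamental sector. -/
structure HasForm (d e c : ℤ) (w : ℕ) : Prop where
  neg : d < 0
  pos : 0 < w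
  form : ∀ a b : ℤ, Complex.normSq ((a : ℂ) + b * omega d) = normForm e c (a, b)
  root : Complex.exp (2 * Real.pi * Complex.I / w) ∈ QuadRing d
  angle : (if d = -1 then Real.pi / 2 else if d = -3 then Real.pi / 3 else Real.pi) =
    2 * Real.pi / w

theorem normSq_of_modEq {d c : ℤ} (hd : d < 0) (h : 1 - d = 4 * c) (a b : ℤ) :
    Complex.normSq ((a : ℂ) + b * omega d) = normForm 1 c (a, b) := by
  have hs : Real.sqrt (-(d : ℝ)) ^ 2 = -(d : ℝ) := Real.sq_sqrt (by
    have : (d : ℝ) < 0 := by exact_mod_cast hd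
    linarith)
  have hm : (1 : ℝ) - d = 4 * c := by exact_mod_cast h
  have h1 : d ≡ 1 [ZMOD 4] := Int.modEq_iff_dvd.2 ⟨c, h⟩
  simp [omega, h1, sqrtNeg, Complex.normSq_apply, normForm]
  linear_combination (b : ℝ) ^ 2 / 4 * hs + (b : ℝ) ^ 2 / 4 * hm

theorem normSq_of_not_modEq {d : ℤ} (hd : d < 0) (h : ¬ d ≡ 1 [ZMOD 4]) (a b : ℤ) :
    Complex.normSq ((a : ℂ) + b * omega d) = normForm 0 (-d) (a, b) := by
  have hs : Real.sqrt (-(d : ℝ)) ^ 2 = -(d : ℝ) := Real.sq_sqrt (by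
    have : (d : ℝ) < 0 := by exact_mod_cast hd
    linarith)
  simp [omega, h, sqrtNeg, Complex.normSq_apply, normForm]
  linear_combination (b : ℝ) ^ 2 * hs

theorem exp_two_pi_div_two_mem (d : ℤ) :
    Complex.exp (2 * Real.pi * Complex.I / (2 : ℕ)) ∈ QuadRing d := by
  have : (2 * Real.pi * Complex.I / (2 : ℕ) : ℂ) = Real.pi * Complex.I := by push_cast; ring
  rw [this, Complex.exp_pi_mul_I]
  exact neg_mem (one_mem _)

theorem hasForm_of_modEq {d c : ℤ} (hd : d < 0) (h : 1 - d = 4 * c) (h1 : d ≠ -1) (h3 : d ≠ -3) :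
    HasForm d 1 c 2 :=
  ⟨hd, by norm_num, normSq_of_modEq hd h, exp_two_pi_div_two_mem d, by
    rw [if_neg h1, if_neg h3]
    push_cast
    ring⟩

theorem hasForm_neg_one : HasForm (-1) 0 1 4 := by
  refine ⟨by norm_num, by norm_num, normSq_of_not_modEq (by norm_num) (by decide), ?_, ?_⟩
  · have h1 : (2 * Real.pi * Complex.I / (4 : ℕ) : ℂ) = Real.pi / 2 * Complex.I := by
      push_cast; ring
    have h2 : Complex.I = omega (-1) := by
      simp [omega, sqrtNeg, show ¬ (-1 : ℤ) ≡ 1 [ZMOD 4] by decide]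
    rw [h1, Complex.exp_pi_div_two_mul_I, h2]
    exact Algebra.subset_adjoin rfl
  · rw [if_pos rfl]
    push_cast
    ring

theorem hasForm_neg_two : HasForm (-2) 0 2 2 := by
  refine ⟨by norm_num, by norm_num, normSq_of_not_modEq (by norm_num) (by decide),
    exp_two_pi_div_two_mem _, ?_⟩
  rw [if_neg (by norm_num), if_neg (by norm_num)]
  push_cast
  ring

theorem hasForm_neg_three : HasForm (-3) 1 1 6 := by
  refine ⟨by norm_num, by norm_num, normSq_of_modEq (by norm_num) (by norm_num), ?_, ?_⟩
  · have h1 : (2 * Real.pi * Complex.I / (6 : ℕ) : ℂ) = ((Real.pi / 3 : ℝ) : ℂ) * Complex.I := by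
      push_cast; ring
    have h2 : Complex.exp (((Real.pi / 3 : ℝ) : ℂ) * Complex.I) = omega (-3) := by
      rw [Complex.exp_mul_I, ← Complex.ofReal_cos, ← Complex.ofReal_sin, Real.cos_pi_div_three,
        Real.sin_pi_div_three]
      simp [omega, sqrtNeg, show (-3 : ℤ) ≡ 1 [ZMOD 4] by decide]
      ring
    rw [h1, h2]
    exact Algebra.subset_adjoin rfl
  · rw [if_neg (by norm_num), if_pos rfl]
    push_cast
    ring

/-- The lattice inequalities are finite sums of rationals, checked exactly by the kernel for each of
the nine forms. -/
theorem exists_form {d : ℤ} (hd : d ∈ K) :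
    ∃ e c : ℤ, ∃ w : ℕ, HasForm d e c w ∧ SmallLatticeSums e c w := by
  simp only [K, Set.mem_insert_iff, Set.mem_singleton_iff] at hd
  rcases hd with rfl | rfl | rfl | rfl | rfl | rfl | rfl | rfl | rfl
  · exact ⟨1, 41, 2, hasForm_of_modEq (by norm_num) (by norm_num) (by norm_num) (by norm_num),
      by decide, by decide, by decide +kernel, by decide +kernel⟩
  · exact ⟨1, 17, 2, hasForm_of_modEq (by norm_num) (by norm_num) (by norm_num) (by norm_num),
      by decide, by decide, by decide +kernel, by decide +kernel⟩
  · exact ⟨1, 11, 2, hasForm_of_modEq (by norm_num) (by norm_num) (by norm_num) (by norm_num),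
      by decide, by decide, by decide +kernel, by decide +kernel⟩
  · exact ⟨1, 5, 2, hasForm_of_modEq (by norm_num) (by norm_num) (by norm_num) (by norm_num),
      by decide, by decide, by decide +kernel, by decide +kernel⟩
  · exact ⟨1, 3, 2, hasForm_of_modEq (by norm_num) (by norm_num) (by norm_num) (by norm_num),
      by decide, by decide, by decide +kernel, by decide +kernel⟩
  · exact ⟨1, 2, 2, hasForm_of_modEq (by norm_num) (by norm_num) (by norm_num) (by norm_num),
      by decide, by decide, by decide +kernel, by decide +kernel⟩
  · exact ⟨1, 1, 6, hasForm_neg_three, by decide, by decide, by decide +kernel, by decide +kernel⟩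
  · exact ⟨0, 2, 2, hasForm_neg_two, by decide, by decide, by decide +kernel, by decide +kernel⟩
  · exact ⟨0, 1, 4, hasForm_neg_one, by decide, by decide, by decide +kernel, by decide +kernel⟩

/-- The abundancy as a sum over codivisors, and `w` times any such sum as a sum over lattice
points. -/
theorem exists_lattice_sum {d e c : ℤ} {w : ℕ} (H : HasForm d e c w) (z : QuadRing d)
    (hz : z ≠ 0) :
    ∃ (D : Finset (QuadRing d)) (v : QuadRing d → ℝ) (T : Finset (ℤ × ℤ)),
      (∀ x ∈ D, 1 ≤ v x) ∧ (∀ x ∈ D, ∃ k : ℤ, v x ^ 2 = k) ∧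
      (∀ n : ℕ, abundancy d n z = ∑ x ∈ D, (v x ^ n)⁻¹) ∧
      (∀ p ∈ T, ∃ x ∈ D, (normForm e c p : ℝ) = v x ^ 2) ∧
      ∀ f : ℝ → ℝ, w * ∑ x ∈ D, f (v x) = ∑ p ∈ T, f (Real.sqrt (normForm e c p)) := by
  classical
  have hfin := finite_divisors d H.neg z hz
  let D := hfin.toFinset
  have hD : ∀ x ∈ D, x ∣ z ∧ x ∈ A d := fun x hx => by simpa [D] using hx
  choose! y hy using fun x hx => (hD x hx).1
  let u : QuadRing d := ⟨_, H.root⟩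
  have hu : ‖(u : ℂ)‖ = 1 := by
    have := Complex.norm_exp_ofReal_mul_I (2 * Real.pi / w)
    rw [← this]
    simp only [u]
    congr 2
    push_cast
    ring
  choose p q hpq using exists_coords d H.neg
  -- Coordinates of the codivisor of `x` rotated by a root of unity; `T` is the image of this map.
  let G : ℕ × QuadRing d → ℤ × ℤ := fun s =>
    (p (u ^ s.1 * y s.2), q (u ^ s.1 * y s.2))
  have hform : ∀ s, (normForm e c (G s) : ℝ) = ‖(y s.2 : ℂ)‖ ^ 2 := by
    intro s
    rw [← H.form, ← hpq, Complex.normSq_eq_norm_sq]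
    simp [hu]
  have hG : Set.InjOn G (Finset.range w ×ˢ D : Finset (ℕ × QuadRing d)) := by
    rintro ⟨k, x⟩ h1 ⟨l, x'⟩ h2 h
    simp only [Finset.coe_product, Set.mem_prod, Finset.mem_coe, Finset.mem_range] at h1 h2
    have h3 : u ^ k * y x = u ^ l * y x' := by
      apply Subtype.ext
      rw [hpq (u ^ k * y x), hpq (u ^ l * y x')]
      simp only [G, Prod.mk.injEq] at h
      rw [h.1, h.2]
    have hy0 : y x ≠ 0 := by
      intro h0
      exact hz (by rw [hy x h1.2, h0, mul_zero])
    have hu0 : u ≠ 0 := by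
      rintro h0
      simp [h0] at hu
    -- Since both products of divisor and codivisor equal `z`, equality of rotated codivisors passes
    -- to the divisors, with the exponents exchanged. The divisors lie in the sector, where
    -- `sector_injective` applies.
    have hyy : y x * (u ^ l * x) = y x * (u ^ k * x') := by
      calc y x * (u ^ l * x) = u ^ l * (x * y x) := by ring
        _ = u ^ l * (x' * y x') := by rw [← hy x h1.2, ← hy x' h2.2]
        _ = x' * (u ^ l * y x') := by ring
        _ = _ := by rw [← h3]; ring
    have h4 := congrArg (Subtype.val) (mul_left_cancel₀ hy0 hyy)
    obtain ⟨hx0, hx1, hx2⟩ := (hD x h1.2).2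
    obtain ⟨hx0', hx1', hx2'⟩ := (hD x' h2.2).2
    rw [H.angle] at hx2 hx2'
    have := sector_injective H.pos hx1 hx2 hx1' hx2' (by simpa using hx0) h2.1 h1.1
      (by simpa [u] using h4)
    exact Prod.ext this.1.symm (Subtype.ext this.2)
  refine ⟨D, fun x => ‖(y x : ℂ)‖, (Finset.range w ×ˢ D).image G, ?_, ?_, ?_, ?_, ?_⟩
  · intro x hx
    refine one_le_norm d H.neg _ fun h0 => hz ?_
    rw [hy x hx, h0, mul_zero]
  · intro x _
    exact ⟨_, (hform (0, x)).symm⟩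
  · intro n
    rw [abundancy, delta, finsum_mem_eq_finite_toFinset_sum _ hfin, Finset.sum_div]
    refine Finset.sum_congr rfl fun x hx => ?_
    have hx0 : (x : ℂ) ≠ 0 := by simpa using (hD x hx).2.1
    have hz' : ‖(z : ℂ)‖ = ‖(x : ℂ)‖ * ‖(y x : ℂ)‖ := by
      conv_lhs => rw [hy x hx]
      simp
    have hx' : ‖(x : ℂ)‖ ≠ 0 := norm_ne_zero_iff.2 hx0
    rw [hz', zpow_natCast, mul_pow, div_mul_eq_div_div, div_self (pow_ne_zero _ hx'), one_div]
  · intro r hr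
    obtain ⟨s, hs, rfl⟩ := Finset.mem_image.1 hr
    exact ⟨s.2, (Finset.mem_product.1 hs).2, hform s⟩
  · intro f
    rw [Finset.sum_image hG, Finset.sum_product]
    simp [hform]

/-! ### Bounds for the abundancy -/

/-- Codivisors have absolute value at least 1, so the exponent can be lowered to 4, where the full
lattice sum is already small enough. -/
theorem abundancy_lt_two_of_even {d e c : ℤ} {w : ℕ} (H : HasForm d e c w)
    (S : SmallLatticeSums e c w) {n : ℕ} (hn : 4 ≤ n) (z : QuadRing d) (hz : z ≠ 0) :
    abundancy d n z < 2 := by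
  obtain ⟨D, v, T, hv, -, hab, -, hsum⟩ := exists_lattice_sum H z hz
  have h1 : abundancy d n z ≤ ∑ x ∈ D, (v x ^ 4)⁻¹ := by
    rw [hab]
    refine Finset.sum_le_sum fun x hx => ?_
    have := hv x hx
    exact inv_anti₀ (by positivity) (pow_le_pow_right₀ this hn)
  have h2 := hsum fun t => (t ^ 4)⁻¹
  have h3 : ∑ p ∈ T, (Real.sqrt (normForm e c p) ^ 4)⁻¹ =
      ∑ p ∈ T, ((normForm e c p : ℝ) ^ 2)⁻¹ := by
    refine Finset.sum_congr rfl fun p _ => ?_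
    have := (three_mul_sq_le_normForm S.middle S.last p).1
    have h0 : (0 : ℝ) ≤ normForm e c p := by
      exact_mod_cast (by nlinarith [sq_nonneg p.1] : 0 ≤ normForm e c p)
    rw [show 4 = 2 * 2 by norm_num, pow_mul, Real.sq_sqrt h0]
  have h4 := sum_inv_normForm_sq_le S.middle S.last T
  have h5 : (((∑ p ∈ Finset.Icc (-8 : ℤ) 8 ×ˢ Finset.Icc (-8 : ℤ) 8,
    ((normForm e c p : ℚ) ^ 2)⁻¹ + 16 / 81 : ℚ)) : ℝ) < ((2 * w : ℚ) : ℝ) :=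
    Rat.cast_lt.2 S.inv_sq
  rw [Rat.cast_add] at h5
  push_cast at h4 h5
  have hw : (0 : ℝ) < w := by exact_mod_cast H.pos
  have h6 : (w : ℝ) * ∑ x ∈ D, (v x ^ 4)⁻¹ < w * 2 := by linarith
  exact h1.trans_lt (lt_of_mul_lt_mul_left h6 hw.le)

/-- A nonnegative real number with an integral square and a rational odd power is a natural
number. -/
theorem exists_nat_of_odd_pow_rational {v : ℝ} (hv : 0 < v) {a : ℤ} (ha : v ^ 2 = a) {n : ℕ}
    (hn : Odd n) {q : ℚ} (hq : v ^ n = q) : ∃ m : ℕ, v = m := by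
  obtain ⟨k, rfl⟩ := hn
  have ha0 : (a : ℝ) ≠ 0 := by rw [← ha]; positivity
  -- With $n=2k+1$, $v=v^n/(v^2)^k$ is rational. Its square is an integer, so $v$ is one too, since
  -- $\mathbb Z$ is integrally closed.
  have h1 : v = ((q / (a : ℚ) ^ k : ℚ) : ℝ) := by
    push_cast
    rw [← hq, pow_succ, pow_mul, ha]
    field_simp
  have h2 : IsIntegral ℤ (q / (a : ℚ) ^ k) := by
    refine IsIntegral.of_pow (n := 2) (by norm_num) ?_
    have : (q / (a : ℚ) ^ k) ^ 2 = (a : ℚ) := by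
      have h3 : (((q / (a : ℚ) ^ k) ^ 2 : ℚ) : ℝ) = ((a : ℚ) : ℝ) := by
        rw [Rat.cast_pow, ← h1, ha]
        simp
      exact_mod_cast h3
    rw [this]
    exact isIntegral_algebraMap (R := ℤ) (x := a)
  obtain ⟨b, hb⟩ := IsIntegrallyClosed.isIntegral_iff.1 h2
  have h3 : v = b := by
    rw [h1, ← hb]
    simp
  have hb0 : 0 ≤ b := by
    rw [h3] at hv
    exact_mod_cast hv.le
  lift b to ℕ using hb0
  exact ⟨b, by simpa using h3⟩

/-- Rationality of the sum makes every $|y|^n$ rational and so, $n$ being odd, every $|y|$ an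
integer. Lowering the exponent to 3 then leaves only the lattice points of square norm. -/
theorem abundancy_lt_two_of_odd {d e c : ℤ} {w : ℕ} (H : HasForm d e c w)
    (S : SmallLatticeSums e c w) {n : ℕ} (hn : 3 ≤ n) (hodd : Odd n) (z : QuadRing d)
    (hz : z ≠ 0) (hq : ∃ q : ℚ, abundancy d n z = q) : abundancy d n z < 2 := by
  obtain ⟨D, v, T, hv, hsq, hab, hT, hsum⟩ := exists_lattice_sum H z hz
  have hnat : ∀ x ∈ D, ∃ m : ℕ, v x = m := by
    have hterm := rational_of_sum_sqrt_rational D (fun x => (v x ^ n)⁻¹) (fun x hx => by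
      have := hv x hx
      positivity) (fun x hx => by
      obtain ⟨k, hk⟩ := hsq x hx
      refine ⟨((k : ℚ) ^ n)⁻¹, ?_⟩
      push_cast
      rw [← hk, inv_pow, ← pow_mul, ← pow_mul, mul_comm]) (by rwa [hab n] at hq)
    intro x hx
    obtain ⟨k, hk⟩ := hsq x hx
    obtain ⟨q, hq⟩ := hterm x hx
    refine exists_nat_of_odd_pow_rational (zero_lt_one.trans_le (hv x hx)) hk hodd (q := q⁻¹) ?_
    rw [Rat.cast_inv, ← hq, inv_inv]
  have h1 : abundancy d n z ≤ ∑ x ∈ D, (v x ^ 3)⁻¹ := by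
    rw [hab]
    refine Finset.sum_le_sum fun x hx => ?_
    have := hv x hx
    exact inv_anti₀ (by positivity) (pow_le_pow_right₀ this hn)
  have h2 := hsum fun t => (t ^ 3)⁻¹
  have hroot : ∀ p ∈ T, ∃ m : ℕ, m ≠ 0 ∧ Real.sqrt (normForm e c p) = m ∧
      normForm e c p = (m : ℤ) ^ 2 := by
    intro p hp
    obtain ⟨x, hx, hpx⟩ := hT p hp
    obtain ⟨m, hm⟩ := hnat x hx
    rw [hm] at hpx
    refine ⟨m, ?_, ?_, by exact_mod_cast hpx⟩
    · have := hv x hx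
      rw [hm] at this
      have : 1 ≤ m := by exact_mod_cast this
      omega
    · rw [hpx, Real.sqrt_sq (Nat.cast_nonneg m)]
  choose! r hr0 hrs hr using hroot
  have h3 : ∑ p ∈ T, (Real.sqrt (normForm e c p) ^ 3)⁻¹ = ∑ p ∈ T, ((r p : ℝ) ^ 3)⁻¹ :=
    Finset.sum_congr rfl fun p hp => by rw [hrs p hp]
  have h4 := sum_inv_sqrt_normForm_cube_le S.middle S.last T r hr0 hr
  have h5 := (Rat.cast_lt (K := ℝ)).2 S.inv_cube
  rw [Rat.cast_add] at h5
  rw [Rat.cast_div, Rat.cast_ofNat, Rat.cast_ofNat, Rat.cast_mul, Rat.cast_ofNat,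
    Rat.cast_natCast] at h5
  have hw : (0 : ℝ) < w := by exact_mod_cast H.pos
  have h6 : (w : ℝ) * ∑ x ∈ D, (v x ^ 3)⁻¹ < w * 2 := by linarith
  exact h1.trans_lt (lt_of_mul_lt_mul_left h6 hw.le)

theorem abundancy_lt_two {d : ℤ} (hd : d ∈ K) {n : ℕ} (hn : 3 ≤ n) (z : QuadRing d) (hz : z ≠ 0)
    (hq : ∃ q : ℚ, abundancy d n z = q) : abundancy d n z < 2 := by
  obtain ⟨e, c, w, H, S⟩ := exists_form hd
  rcases Nat.even_or_odd n with h | h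
  · have : 4 ≤ n := by
      obtain ⟨k, rfl⟩ := h
      omega
    exact abundancy_lt_two_of_even H S this z hz
  · exact abundancy_lt_two_of_odd H S hn h z hz hq

end QuadPerfect

theorem theorem2p1 (d : ℤ) (hd : d ∈ QuadPerfect.K) (n : ℕ) (hn : 3 ≤ n) :
    (∀ z : QuadPerfect.QuadRing d, z ≠ 0 →
      (∃ q : ℚ, QuadPerfect.abundancy d n z = (q : ℝ)) → QuadPerfect.abundancy d n z < 2) ∧
    (∀ t : ℕ, 2 ≤ t → ¬ ∃ z : QuadPerfect.QuadRing d, QuadPerfect.IsPowerfullyPerfect d n t z) := by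
  refine ⟨fun z hz hq => QuadPerfect.abundancy_lt_two hd hn z hz hq, ?_⟩
  rintro t ht ⟨z, hz, hzt⟩
  -- A perfect number has abundancy `t`, which is rational, so the first part gives `t < 2`.
  have h := QuadPerfect.abundancy_lt_two hd hn z hz ⟨t, by simpa using hzt⟩
  rw [hzt] at h
  have : t < 2 := by exact_mod_cast h
  omega
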